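/- Let $\eta_1,\eta_2\in\mathbb R$ and $P_0,P_1,P_2,Q_1,Q_2\ge 0$. Consider the memoryless channel with outputs $Y_k=\eta_kX_0+X_k+S_k+Z_k$, $k=1,2$, where $Z_k\sim\mathcal N(0,1)$, $S_k\sim\mathcal N(0,Q_k)$, and $S_1,S_2,Z_1,Z_2$ are independent and i.i.d. over time. A $(2^{nR_1},2^{nR_2},n)$ code has message sets $[1:2^{nR_k}]=\{1,\dots,\lfloor 2^{nR_k}\rfloor\}$, a helper encoder $x_0^n(s_1^n,s_2^n)$ that knows both state sequences noncausally, encoders $x_k^n(m_k)$, and decoders that map $y_k^n$ to a message or to an error symbol. The messages $M_1,M_2$ are independent of each other and of the states and noises, and uniform, and the inputs satisfy $\frac1n\sum_{i=1}^n\mathbb E[X_{j,i}^2]\le P_j$ for $j=0,1,2$. A pair $(R_1,R_2)$ with $R_1,R_2\ge0$ is achievable if there is a sequence of such codes, $n=1,2,\dots$, with $\Pr(\hat M_1\ne M_1\text{ or }\hat M_2\ne M_2)\to0$ as $n\to\infty$. Then for every achievable pair $(R_1,R_2)$ there are real numbers $\rho_{0S_1},\rho_{0S_2}$ with $\rho_{0S_1}^2+\rho_{0S_2}^2\le1$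 such that, for both $k=1$ and $k=2$ (with logarithms to base $2$), $$R_k\le\min\Big\{\tfrac12\log\Big(1+\frac{P_k}{\eta_k^2P_0+2\eta_k\rho_{0S_k}\sqrt{P_0Q_k}+Q_k+1}\Big)+\tfrac12\log\big((1-\rho_{0S_1}^2-\rho_{0S_2}^2)\eta_k^2P_0+1\big),\ \tfrac12\log(1+P_k)\Big\}.$$ -/

import Mathlib

open MeasureTheory ProbabilityTheory Filter Topology

/-- Parameters of the parallel Gaussian channel with a helper
`Y k = η k * X₀ + X k + S k + Z k`, `Z k ~ N(0, 1)`, `S k ~ N(0, Q k)`.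
The two subchannels are indexed by `Fin 2`; `P₀` is the power of the helper and `P k` the power of
transmitter `k`. -/
structure HelperChannel where
  /-- channel gains from the helper to the receivers -/
  η : Fin 2 → ℝ
  /-- power of the helper -/
  P₀ : NNReal
  /-- powers of the transmitters -/
  P : Fin 2 → NNReal
  /-- state variances -/
  Q : Fin 2 → NNReal

/-- A code of block length `n` with message sets `Fin (M 0)`, `Fin (M 1)`. -/
structure HelperCode (n : ℕ) (M : Fin 2 → ℕ) where
  /-- helper encoder: the pair of whole state sequences is known in advance (noncausally) -/
  helper : (Fin 2 → Fin n → ℝ) → Fin n → ℝ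
  measurable_helper : Measurable helper
  /-- encoder `k` sees its own message only -/
  enc : ∀ k : Fin 2, Fin (M k) → Fin n → ℝ
  /-- decoder `k` sees the output sequence `k` only; `none` is the error message -/
  dec : ∀ k : Fin 2, (Fin n → ℝ) → Option (Fin (M k))
  measurableSet_dec : ∀ k m, MeasurableSet (dec k ⁻¹' {m})

namespace HelperChannel

/-- Law of the message pair: independent, each uniform on its message set. -/
noncomputable def messageLaw (M : Fin 2 → ℕ) : Measure (∀ k, Fin (M k)) :=
  Measure.pi fun _ => uniformOn Set.univ

/-- Law of the two state sequences: independent of each other, `S k` i.i.d. `N(0, Q k)`. -/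
noncomputable def stateLaw (W : HelperChannel) (n : ℕ) : Measure (Fin 2 → Fin n → ℝ) :=
  Measure.pi fun k => Measure.pi fun _ => gaussianReal 0 (W.Q k)

/-- Law of the two noise sequences: independent of each other, each i.i.d. `N(0, 1)`. -/
noncomputable def noiseLaw (n : ℕ) : Measure (Fin 2 → Fin n → ℝ) :=
  Measure.pi fun _ => Measure.pi fun _ => gaussianReal 0 1

/-- Joint law of (messages, states, noises), which are independent. -/
noncomputable def jointLaw (W : HelperChannel) (n : ℕ) (M : Fin 2 → ℕ) :
    Measure ((∀ k, Fin (M k)) × (Fin 2 → Fin n → ℝ) × (Fin 2 → Fin n → ℝ)) :=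
  (messageLaw M).prod ((W.stateLaw n).prod (noiseLaw n))

/-- Output sequence at receiver `k` for messages `m`, states `s` and noises `z`. -/
def output (W : HelperChannel) {n : ℕ} {M : Fin 2 → ℕ} (c : HelperCode n M) (k : Fin 2)
    (m : ∀ k, Fin (M k)) (s z : Fin 2 → Fin n → ℝ) : Fin n → ℝ :=
  fun i => W.η k * c.helper s i + c.enc k (m k) i + s k i + z k i

/-- Average probability that at least one of the two messages is decoded incorrectly. -/
noncomputable def errorProb (W : HelperChannel) {n : ℕ} {M : Fin 2 → ℕ} (c : HelperCode n M) : ℝ :=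
  (W.jointLaw n M).real
    {ω | ∃ k, c.dec k (W.output c k ω.1 ω.2.1 ω.2.2) ≠ some (ω.1 k)}

/-- Expected average power constraints: `(1/n) ∑ᵢ E[X₀ᵢ²] ≤ P₀` and `(1/n) ∑ᵢ E[Xₖᵢ²] ≤ Pₖ`
for both `k`. The expectations are `[0, ∞]`-valued, so no infinite one passes. -/
def PowerConstraint (W : HelperChannel) {n : ℕ} {M : Fin 2 → ℕ} (c : HelperCode n M) : Prop :=
  (∫⁻ s, ∑ i, ENNReal.ofReal (c.helper s i ^ 2) ∂(W.stateLaw n) ≤ n * W.P₀) ∧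
  ∀ k, ∫⁻ m, ∑ i, ENNReal.ofReal (c.enc k (m k) i ^ 2) ∂(messageLaw M) ≤ n * W.P k

/-- The sizes of the message sets `[1 : 2 ^ (n R k)]`. -/
noncomputable def messageCount (R : Fin 2 → ℝ) (n : ℕ) (k : Fin 2) : ℕ :=
  ⌊(2 : ℝ) ^ ((n : ℝ) * R k)⌋₊

/-- The rate pair `R` is achievable: there is a sequence of `(2^{nR₁}, 2^{nR₂}, n)` codes that meet
the power constraints and whose average error probability tends to `0`. -/
def IsAchievable (W : HelperChannel) (R : Fin 2 → ℝ) : Prop :=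
  (∀ k, 0 ≤ R k) ∧
  ∃ c : ∀ n : ℕ, HelperCode n (messageCount R n),
    (∀ n, W.PowerConstraint (c n)) ∧ Tendsto (fun n => W.errorProb (c n)) atTop (𝓝 0)

end HelperChannel

open scoped NNReal ENNReal

/-! ### Products of Gaussian laws: coordinatewise images and densities -/

section PiMeasures

variable {ι : Type*} [Fintype ι]

/-! A change of measure takes the place of Fano's inequality and differential entropy. Suppose that
for each message `m` the law of states and noise, reweighted by `exp (L m)`, gives the output a law
that does not depend on `m`. Then `e^x ≥ 1 + x` yields log M · Σ P(m is decoded) ≤ M + Σ E[-L m]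
(`log_mul_sum_measureReal_le`), so every explicit choice of `L` gives a converse.

If the states are revealed to the receiver, trading codeword plus noise for a Gaussian of variance 1
+ P_k gives the bound ½ log(1 + P_k). For the other bound let V = u(S) + Z, where u(S) = η_k X₀ +
S_k. The reweighting makes V given S Gaussian with mean Σ a_j S_j and variance B, hence V itself
N(0, A), and then replaces this marginal so that the output is Gaussian with variance A + P_k. Up to
quadratic terms E[-L] is n/2 (log(A + P_k) - log A + log B). In entropy language this is I(M; Y) ≤
h(Y) - h(Z) - I(S; V), with I(S; V) bounded below by means of a linear Gaussian backward channel, so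
no Gaussianity of the helper signal is needed (`log_card_le_of_unknown_state`).

The helper signal enters only through its energy and its time-averaged correlations with the two
states. Bessel's inequality puts the normalised correlations ρ in the unit disc
(`exists_correlation`), and the regression coefficients on the states supply a. The same helper
signal reaches both receivers, so one ρ serves both. Normalising by the budget P₀ rather than by the
power actually spent lowers the energies matching A and B by the same δ ≥ 0, which is harmless
because B ≤ A. The disc is compact and the bounds are continuous in ρ, so a convergent subsequence
of the ρ of the individual codes gives the limiting statement. -/

theorem pi_prod_pi_map {X Y Z : Type*} [MeasurableSpace X] [MeasurableSpace Y] [MeasurableSpace Z]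
    (μ : Measure X) (ν : Measure Y) [IsProbabilityMeasure μ] [IsProbabilityMeasure ν]
    {F : X × Y → Z} (hF : Measurable F) :
    ((Measure.pi fun _ : ι => μ).prod (Measure.pi fun _ : ι => ν)).map
      (fun p i => F (p.1 i, p.2 i)) = Measure.pi fun _ => (μ.prod ν).map F := by
  have h := (measurePreserving_arrowProdEquivProdArrow X Y ι (fun _ => μ) (fun _ => ν)).map_eq
  rw [← h, Measure.map_map (by fun_prop) (by fun_prop)]
  have : IsProbabilityMeasure ((μ.prod ν).map F) := Measure.isProbabilityMeasure_map hF.aemeasurable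
  rw [← Measure.pi_map_pi (μ := fun _ : ι => μ.prod ν) (f := fun _ => F) fun _ => hF.aemeasurable]
  rfl

theorem pi_gaussianReal_eq_withDensity {v : ℝ≥0} (hv : v ≠ 0) :
    (Measure.pi fun _ : ι => gaussianReal 0 v) =
      volume.withDensity fun z : ι → ℝ => ENNReal.ofReal (∏ i, gaussianPDFReal 0 v (z i)) := by
  refine Measure.pi_eq fun s hs => ?_
  rw [withDensity_apply _ (MeasurableSet.univ_pi hs), ← lintegral_indicator (MeasurableSet.univ_pi hs)]
  -- The indicator of a box factorises over the coordinates, so Fubini applies to the restricted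
  -- density.
  have h1 : (Set.univ.pi s).indicator
      (fun z : ι → ℝ => ENNReal.ofReal (∏ i, gaussianPDFReal 0 v (z i))) =
      fun z => ENNReal.ofReal (∏ i, (s i).indicator (gaussianPDFReal 0 v) (z i)) := by
    ext z
    by_cases hz : z ∈ Set.univ.pi s
    · rw [Set.indicator_of_mem hz]
      congr 1
      exact Finset.prod_congr rfl fun i _ => by rw [Set.indicator_of_mem (hz i trivial)]
    · rw [Set.indicator_of_notMem hz]
      simp only [Set.mem_pi, Set.mem_univ, true_implies, not_forall] at hz
      obtain ⟨i, hi⟩ := hz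
      rw [Finset.prod_eq_zero (Finset.mem_univ i) (Set.indicator_of_notMem hi _)]
      simp
  have hint : ∀ i, Integrable ((s i).indicator (gaussianPDFReal 0 v)) volume := fun i =>
    (integrable_gaussianPDFReal 0 v).indicator (hs i)
  have hnn : ∀ i x, 0 ≤ (s i).indicator (gaussianPDFReal 0 v) x := fun i x =>
    Set.indicator_nonneg (fun _ _ => gaussianPDFReal_nonneg _ _ _) x
  simp only [h1]
  have hprod : Integrable (fun z : ι → ℝ => ∏ i, (s i).indicator (gaussianPDFReal 0 v) (z i)) :=
    Integrable.fintype_prod fun i => hint i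
  rw [← ofReal_integral_eq_lintegral_ofReal hprod
    (ae_of_all _ fun z => Finset.prod_nonneg fun i _ => hnn i _),
    integral_fintype_prod_volume_eq_prod (fun i => (s i).indicator (gaussianPDFReal 0 v)),
    ENNReal.ofReal_prod_of_nonneg fun i _ => integral_nonneg (hnn i)]
  refine Finset.prod_congr rfl fun i _ => ?_
  rw [gaussianReal_apply_eq_integral _ hv, integral_indicator (hs i)]

theorem prod_gaussianReal_map_add (v w : ℝ≥0) :
    ((gaussianReal 0 v).prod (gaussianReal 0 w)).map (fun p => p.1 + p.2) =
      gaussianReal 0 (v + w) := by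
  have h := gaussianReal_conv_gaussianReal (m₁ := 0) (m₂ := 0) (v₁ := v) (v₂ := w)
  rwa [add_zero] at h

theorem pi_gaussianReal_prod_map_add (v w : ℝ≥0) :
    ((Measure.pi fun _ : ι => gaussianReal 0 v).prod
      (Measure.pi fun _ : ι => gaussianReal 0 w)).map (fun p => p.1 + p.2) =
      Measure.pi fun _ => gaussianReal 0 (v + w) := by
  have := pi_prod_pi_map (ι := ι) (gaussianReal 0 v) (gaussianReal 0 w)
    (F := fun p => p.1 + p.2) (by fun_prop)
  rw [prod_gaussianReal_map_add] at this
  exact this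

end PiMeasures

namespace HelperChannel

variable (W : HelperChannel) (n : ℕ)

instance : IsProbabilityMeasure (W.stateLaw n) := by unfold stateLaw; infer_instance

theorem stateLaw_map_linear (a : Fin 2 → ℝ) :
    (W.stateLaw n).map (fun s i => ∑ j, a j * s j i) =
      Measure.pi fun _ => gaussianReal 0 (∑ j, NNReal.mk (a j ^ 2) (sq_nonneg _) * W.Q j) := by
  have h := (measurePreserving_piFinTwo
    fun k => Measure.pi fun _ : Fin n => gaussianReal 0 (W.Q k)).map_eq
  have h2 := pi_prod_pi_map (ι := Fin n) (gaussianReal 0 (W.Q 0)) (gaussianReal 0 (W.Q 1))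
    (F := fun p => a 0 * p.1 + a 1 * p.2) (by fun_prop)
  rw [← h, Measure.map_map (by fun_prop) (by fun_prop)] at h2
  have h3 : ((gaussianReal 0 (W.Q 0)).prod (gaussianReal 0 (W.Q 1))).map
      (fun p => a 0 * p.1 + a 1 * p.2) =
      gaussianReal 0 (∑ j, NNReal.mk (a j ^ 2) (sq_nonneg _) * W.Q j) := by
    have e0 := gaussianReal_map_const_mul (μ := 0) (v := W.Q 0) (a 0)
    have e1 := gaussianReal_map_const_mul (μ := 0) (v := W.Q 1) (a 1)
    rw [mul_zero] at e0 e1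
    rw [Fin.sum_univ_two, ← prod_gaussianReal_map_add, ← e0, ← e1,
      Measure.map_prod_map _ _ (by fun_prop) (by fun_prop),
      Measure.map_map (by fun_prop) (by fun_prop)]
    rfl
  rw [h3] at h2
  rw [← h2, stateLaw]
  congr 1
  ext s i
  simp [Fin.sum_univ_two, MeasurableEquiv.piFinTwo]

/-- The reference model for the interference plus noise: a linear function of the states plus
independent Gaussian noise of variance `B`. Its marginal is what the likelihood ratio divides out.
-/
theorem stateLaw_prod_map_linear (a : Fin 2 → ℝ) (B : ℝ≥0) :
    ((W.stateLaw n).prod (Measure.pi fun _ : Fin n => gaussianReal 0 B)).map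
      (fun p i => ∑ j, a j * p.1 j i + p.2 i) =
      Measure.pi fun _ => gaussianReal 0 (∑ j, NNReal.mk (a j ^ 2) (sq_nonneg _) * W.Q j + B) := by
  rw [← pi_gaussianReal_prod_map_add, ← stateLaw_map_linear]
  conv_rhs => rw [← Measure.map_id (μ := Measure.pi fun _ : Fin n => gaussianReal 0 B)]
  rw [Measure.map_prod_map _ _ (by fun_prop) (by fun_prop),
    Measure.map_map (by fun_prop) (by fun_prop)]
  rfl

end HelperChannel

/-! ### Converse by change of measure -/

section ChangeOfMeasure

variable {Ω E : Type*} [MeasurableSpace Ω] [MeasurableSpace E]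

/-- The bound `x + 1 ≤ exp x`, taken at `L + log c` on the decision event and at `L` off it, is
integrated; under the reweighted law the event has probability `κ D`. It plays the part of data
processing for relative entropy. -/
theorem integral_add_mul_measureReal_le (P : Measure Ω) [IsProbabilityMeasure P]
    (κ : Measure E) [IsProbabilityMeasure κ] {L : Ω → ℝ} {Y : Ω → E} (hL : Measurable L)
    (hLi : Integrable L P) (hY : Measurable Y)
    (hκ : (P.withDensity fun ω => ENNReal.ofReal (Real.exp (L ω))).map Y = κ)
    {D : Set E} (hD : MeasurableSet D) {c : ℝ} (hc : 0 < c) :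
    ∫ ω, L ω ∂P + Real.log c * P.real (Y ⁻¹' D) ≤ (c - 1) * κ.real D := by
  have hm : Measurable fun ω => ENNReal.ofReal (Real.exp (L ω)) := by fun_prop
  have key : ∀ S : Set E, MeasurableSet S →
      ∫⁻ ω in Y ⁻¹' S, ENNReal.ofReal (Real.exp (L ω)) ∂P = κ S := fun S hS => by
    rw [← hκ, Measure.map_apply hY hS, withDensity_apply _ (hY hS)]
  have hexp : Integrable (fun ω => Real.exp (L ω)) P := by
    refine ⟨by fun_prop, ?_⟩
    rw [hasFiniteIntegral_iff_ofReal (ae_of_all _ fun _ => (Real.exp_pos _).le)]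
    have := key Set.univ .univ
    simp only [Set.preimage_univ, Measure.restrict_univ, measure_univ] at this
    simp [this]
  have hint : ∀ S : Set E, MeasurableSet S →
      ∫ ω in Y ⁻¹' S, Real.exp (L ω) ∂P = κ.real S := fun S hS => by
    rw [integral_eq_lintegral_of_nonneg_ae (ae_of_all _ fun _ => (Real.exp_pos _).le)
      (by fun_prop), key S hS]
    rfl
  have hone : ∫ ω, Real.exp (L ω) ∂P = 1 := by
    have := hint Set.univ .univ
    simpa using this
  have hA : MeasurableSet (Y ⁻¹' D) := hY hD
  have hpt : ∀ ω, L ω + Real.log c * (Y ⁻¹' D).indicator 1 ω ≤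
      Real.exp (L ω) + (c - 1) * (Y ⁻¹' D).indicator (fun ω => Real.exp (L ω)) ω - 1 := by
    intro ω
    by_cases h : ω ∈ Y ⁻¹' D
    · simp only [Set.indicator_of_mem h, Pi.one_apply, mul_one]
      have := Real.add_one_le_exp (L ω + Real.log c)
      rw [Real.exp_add, Real.exp_log hc] at this
      linarith
    · simp only [Set.indicator_of_notMem h, mul_zero, add_zero]
      have := Real.add_one_le_exp (L ω)
      linarith
  have hi1 : Integrable ((Y ⁻¹' D).indicator (1 : Ω → ℝ)) P :=
    (integrable_const (1 : ℝ)).indicator hA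
  have hi2 := hexp.indicator hA
  have hadd : Integrable (fun ω => Real.exp (L ω) +
      (c - 1) * (Y ⁻¹' D).indicator (fun ω => Real.exp (L ω)) ω) P :=
    hexp.add (hi2.const_mul (c - 1))
  have h := integral_mono (hLi.add (hi1.const_mul (Real.log c)))
    (hadd.sub (integrable_const 1)) hpt
  simp only [Pi.add_apply, Pi.sub_apply] at h
  rw [integral_add hLi (hi1.const_mul _), integral_const_mul, integral_indicator_one hA,
    integral_sub hadd (integrable_const 1),
    integral_add hexp (hi2.const_mul _), integral_const_mul, integral_indicator hA,
    hint D hD, hone] at h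
  simpa using h

/-- Converse bound for a decoder with disjoint decision regions `D m`, by a change of measure that
makes the law of the output independent of the message. -/
theorem log_mul_sum_measureReal_le (P : Measure Ω) [IsProbabilityMeasure P]
    (κ : Measure E) [IsProbabilityMeasure κ] {M : ℕ} (hM : 0 < M) {L : Fin M → Ω → ℝ}
    {Y : Fin M → Ω → E} (hL : ∀ m, Measurable (L m)) (hLi : ∀ m, Integrable (L m) P)
    (hY : ∀ m, Measurable (Y m))
    (hκ : ∀ m, (P.withDensity fun ω => ENNReal.ofReal (Real.exp (L m ω))).map (Y m) = κ)
    {D : Fin M → Set E} (hD : ∀ m, MeasurableSet (D m)) (hdisj : Pairwise (Function.onFun Disjoint D)) :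
    Real.log M * ∑ m, P.real (Y m ⁻¹' D m) ≤ M + ∑ m, ∫ ω, -L m ω ∂P := by
  have hM1 : (1 : ℝ) ≤ M := by exact_mod_cast hM
  -- With `c = M` the right-hand sides add up to at most `M - 1`, since the regions are disjoint and
  -- `κ` is a probability measure.
  have h := Finset.sum_le_sum fun m (_ : m ∈ Finset.univ) =>
    integral_add_mul_measureReal_le P κ (hL m) (hLi m) (hY m) (hκ m) (hD m)
      (c := M) (by linarith)
  have hsum : ∑ m, κ.real (D m) ≤ 1 := by
    have := measureReal_iUnion_fintype (μ := κ) hdisj hD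
    rw [← this]
    exact measureReal_le_one
  rw [Finset.sum_add_distrib, ← Finset.mul_sum, ← Finset.mul_sum] at h
  simp only [integral_neg, Finset.sum_neg_distrib]
  nlinarith

end ChangeOfMeasure

/-! ### Gaussian densities and likelihood ratios -/

section PiDensity

variable {ι : Type*} [Fintype ι]

/-- The density of the centred Gaussian law with covariance `v • 1` on `ι → ℝ`. -/
noncomputable def piGaussianPDF (v : ℝ≥0) (z : ι → ℝ) : ℝ := ∏ i, gaussianPDFReal 0 v (z i)

theorem piGaussianPDF_pos {v : ℝ≥0} (hv : v ≠ 0) (z : ι → ℝ) : 0 < piGaussianPDF v z :=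
  Finset.prod_pos fun _ _ => gaussianPDFReal_pos _ _ _ hv

@[fun_prop]
theorem measurable_piGaussianPDF (v : ℝ≥0) : Measurable (piGaussianPDF (ι := ι) v) := by
  unfold piGaussianPDF
  exact Finset.measurable_prod _ fun i _ => (measurable_gaussianPDFReal 0 v).comp (measurable_pi_apply i)

theorem log_piGaussianPDF {v : ℝ≥0} (hv : v ≠ 0) (z : ι → ℝ) :
    Real.log (piGaussianPDF v z) =
      -(Fintype.card ι / 2 * Real.log (2 * Real.pi * v)) - (∑ i, z i ^ 2) / (2 * v) := by
  have hpos : (0 : ℝ) < v := by exact_mod_cast pos_iff_ne_zero.mpr hv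
  rw [piGaussianPDF, Real.log_prod fun i _ => (gaussianPDFReal_pos 0 v _ hv).ne']
  have : ∀ i, Real.log (gaussianPDFReal 0 v (z i)) =
      -(1 / 2 * Real.log (2 * Real.pi * v)) - z i ^ 2 / (2 * v) := fun i => by
    rw [gaussianPDFReal, Real.log_mul (by positivity) (Real.exp_pos _).ne', Real.log_exp,
      Real.log_inv, Real.log_sqrt (by positivity)]
    ring
  simp only [this, Finset.sum_sub_distrib, Finset.sum_const, Finset.card_univ, nsmul_eq_mul,
    Finset.sum_div]
  ring

theorem lintegral_pi_gaussianReal {v : ℝ≥0} (hv : v ≠ 0) {h : (ι → ℝ) → ℝ≥0∞} (hh : Measurable h) :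
    ∫⁻ z, h z ∂(Measure.pi fun _ : ι => gaussianReal 0 v) =
      ∫⁻ z, ENNReal.ofReal (piGaussianPDF v z) * h z := by
  rw [pi_gaussianReal_eq_withDensity hv, lintegral_withDensity_eq_lintegral_mul _ _ hh]
  · rfl
  · exact (measurable_piGaussianPDF v).ennreal_ofReal

end PiDensity

/-- Likelihood ratio for a receiver that knows the states: the true conditional law of the output
is traded for a Gaussian law of variance `τ` around `t + u s`. -/
theorem map_withDensity_of_known_state {Ω : Type*} [MeasurableSpace Ω] (ν : Measure Ω)
    [IsProbabilityMeasure ν] {n : ℕ} {τ : ℝ≥0} (hτ : τ ≠ 0) {u : Ω → Fin n → ℝ} (hu : Measurable u)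
    (x t : Fin n → ℝ) :
    ((ν.prod (Measure.pi fun _ : Fin n => gaussianReal 0 1)).withDensity fun p =>
      ENNReal.ofReal (Real.exp (Real.log (piGaussianPDF τ (x + p.2 - t)) -
        Real.log (piGaussianPDF 1 p.2)))).map (fun p => x + (u p.1 + p.2)) =
    (ν.prod (Measure.pi fun _ : Fin n => gaussianReal 0 τ)).map
      (fun p => p.2 + t + u p.1) := by
  refine Measure.ext_of_lintegral _ fun h hh => ?_
  rw [lintegral_map hh (by fun_prop), lintegral_map hh (by fun_prop),
    lintegral_withDensity_eq_lintegral_mul _ (by fun_prop) (by fun_prop)]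
  simp only [Pi.mul_apply]
  rw [lintegral_prod _ (by fun_prop), lintegral_prod _ (by fun_prop)]
  refine lintegral_congr fun s => ?_
  rw [lintegral_pi_gaussianReal one_ne_zero (by fun_prop),
    lintegral_pi_gaussianReal hτ (by fun_prop)]
  -- Translation invariance of Lebesgue measure: the Gaussian variable on the right is `x + z - t`.
  conv_rhs => rw [← lintegral_add_right_eq_self _ (x - t)]
  refine lintegral_congr fun z => ?_
  have h1 := piGaussianPDF_pos (v := 1) one_ne_zero z
  rw [← mul_assoc, ← ENNReal.ofReal_mul h1.le, Real.exp_sub,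
    Real.exp_log (piGaussianPDF_pos hτ _), Real.exp_log h1, mul_div_cancel₀ _ h1.ne']
  have e : z + (x - t) + t + u s = x + (u s + z) := by abel
  have e' : z + (x - t) = x + z - t := by abel
  rw [e, e']

namespace HelperChannel

variable (W : HelperChannel) (n : ℕ)

/-- Likelihood ratio for a receiver that does not know the states: besides the output law, the
law of the states given the interference is traded for a linear Gaussian one. -/
theorem map_withDensity_of_unknown_state {A B τ : ℝ≥0} (hA : A ≠ 0) (hB : B ≠ 0) (hτ : τ ≠ 0)
    (a : Fin 2 → ℝ) (hAB : A = ∑ j, NNReal.mk (a j ^ 2) (sq_nonneg _) * W.Q j + B)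
    {u : (Fin 2 → Fin n → ℝ) → Fin n → ℝ} (hu : Measurable u) (x t : Fin n → ℝ) :
    (((W.stateLaw n).prod (Measure.pi fun _ : Fin n => gaussianReal 0 1)).withDensity fun p =>
      ENNReal.ofReal (Real.exp (Real.log (piGaussianPDF B (u p.1 + p.2 - fun i => ∑ j, a j * p.1 j i))
        + Real.log (piGaussianPDF τ (x + (u p.1 + p.2) - t))
        - Real.log (piGaussianPDF A (u p.1 + p.2)) - Real.log (piGaussianPDF 1 p.2)))).map
      (fun p => x + (u p.1 + p.2)) =
    (Measure.pi fun _ : Fin n => gaussianReal 0 τ).map (fun w => w + t) := by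
  refine Measure.ext_of_lintegral _ fun h hh => ?_
  rw [lintegral_map hh (by fun_prop), lintegral_map hh (by fun_prop),
    lintegral_withDensity_eq_lintegral_mul _ (by fun_prop) (by fun_prop)]
  simp only [Pi.mul_apply]
  -- The part of the integrand that depends on the interference plus noise `v` alone. What remains
  -- turns the law of `v` given the states into a Gaussian of variance `B` around `∑ j, a j * s j`.
  set H : (Fin n → ℝ) → ℝ≥0∞ := fun v =>
    ENNReal.ofReal (piGaussianPDF τ (x + v - t) / piGaussianPDF A v) * h (x + v) with hH
  have hHm : Measurable H := by fun_prop
  calc _ = ∫⁻ s, ∫⁻ b, H ((fun i => ∑ j, a j * s j i) + b)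
        ∂(Measure.pi fun _ : Fin n => gaussianReal 0 B) ∂(W.stateLaw n) := by
        rw [lintegral_prod _ (by fun_prop)]
        refine lintegral_congr fun s => ?_
        rw [lintegral_pi_gaussianReal one_ne_zero (by fun_prop),
          lintegral_pi_gaussianReal hB (by fun_prop)]
        conv_rhs => rw [← lintegral_add_right_eq_self _ (u s - fun i => ∑ j, a j * s j i)]
        refine lintegral_congr fun z => ?_
        have h1 := piGaussianPDF_pos (v := 1) one_ne_zero z
        have e : (fun i => ∑ j, a j * s j i) + (z + (u s - fun i => ∑ j, a j * s j i)) = u s + z := by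
          abel
        have e' : z + (u s - fun i => ∑ j, a j * s j i) = u s + z - fun i => ∑ j, a j * s j i := by
          abel
        rw [e, e', hH]
        simp only
        rw [← mul_assoc, ← mul_assoc, ← ENNReal.ofReal_mul h1.le,
          ← ENNReal.ofReal_mul (piGaussianPDF_pos hB _).le, Real.exp_sub, Real.exp_sub, Real.exp_add,
          Real.exp_log (piGaussianPDF_pos hτ _), Real.exp_log h1,
          Real.exp_log (piGaussianPDF_pos hA _), Real.exp_log (piGaussianPDF_pos hB _),
          mul_div_cancel₀ _ h1.ne', mul_div_assoc]
    -- Averaging over the states leaves the marginal `N(0, A)`, whose density cancels the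
    -- denominator of `H`.
    _ = ∫⁻ v, H v ∂(Measure.pi fun _ : Fin n => gaussianReal 0 A) := by
        rw [hAB, ← stateLaw_prod_map_linear, lintegral_map hHm (by fun_prop),
          lintegral_prod _ (by fun_prop)]
        rfl
    _ = _ := by
        rw [lintegral_pi_gaussianReal hA hHm, lintegral_pi_gaussianReal hτ (by fun_prop)]
        conv_rhs => rw [← lintegral_add_right_eq_self _ (x - t)]
        refine lintegral_congr fun z => ?_
        have h1 := piGaussianPDF_pos hA z
        rw [hH]
        simp only
        rw [← mul_assoc, ← ENNReal.ofReal_mul h1.le, mul_div_cancel₀ _ h1.ne']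
        have e : z + (x - t) + t = x + z := by abel
        have e' : z + (x - t) = x + z - t := by abel
        rw [e, e']

end HelperChannel

/-! ### Second moments of states, noise and helper signal -/

section SecondMoments

variable {Ω : Type*} [MeasurableSpace Ω]

theorem memLp_two_gaussianReal (v : ℝ≥0) : MemLp (fun x : ℝ => x) 2 (gaussianReal 0 v) :=
  memLp_id_gaussianReal' 2 (by simp)

theorem integral_sq_gaussianReal (v : ℝ≥0) : ∫ x, x ^ 2 ∂(gaussianReal 0 v) = v := by
  have h := variance_id_gaussianReal (μ := 0) (v := v)
  rw [variance_eq_sub (memLp_id_gaussianReal' 2 (by simp))] at h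
  simpa using h

theorem memLp_eval_pi_gaussianReal {ι : Type*} [Fintype ι] (v : ℝ≥0) (i : ι) :
    MemLp (fun z : ι → ℝ => z i) 2 (Measure.pi fun _ => gaussianReal 0 v) :=
  (memLp_two_gaussianReal v).comp_measurePreserving
    (measurePreserving_eval (fun _ : ι => gaussianReal 0 v) i)

/-- Adding independent standard Gaussian noise raises the second moment of each letter by one. -/
theorem integrable_sq_add_noise {ι : Type*} [Fintype ι] {ν : Measure Ω} [IsProbabilityMeasure ν]
    {g : Ω → ι → ℝ} (hg : ∀ i, MemLp (fun s => g s i) 2 ν) :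
    Integrable (fun p => ∑ i, (g p.1 + p.2) i ^ 2)
        (ν.prod (Measure.pi fun _ : ι => gaussianReal 0 1)) ∧
      ∫ p, ∑ i, (g p.1 + p.2) i ^ 2 ∂(ν.prod (Measure.pi fun _ : ι => gaussianReal 0 1)) =
        ∑ i, ∫ s, g s i ^ 2 ∂ν + Fintype.card ι := by
  set γ := Measure.pi fun _ : ι => gaussianReal 0 1 with hγ
  have hz : ∀ i, MemLp (fun z : ι → ℝ => z i) 2 γ := memLp_eval_pi_gaussianReal 1
  have h1 : ∀ i, Integrable (fun p : Ω × (ι → ℝ) => g p.1 i ^ 2) (ν.prod γ) := fun i =>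
    (hg i).integrable_sq.comp_fst γ
  have h2 : ∀ i, Integrable (fun p : Ω × (ι → ℝ) => g p.1 i * p.2 i) (ν.prod γ) := fun i =>
    ((hg i).integrable one_le_two).mul_prod ((hz i).integrable one_le_two)
  have h3 : ∀ i, Integrable (fun p : Ω × (ι → ℝ) => p.2 i ^ 2) (ν.prod γ) := fun i =>
    (hz i).integrable_sq.comp_snd ν
  have hexp : ∀ i (p : Ω × (ι → ℝ)), (g p.1 + p.2) i ^ 2 =
      g p.1 i ^ 2 + 2 * (g p.1 i * p.2 i) + p.2 i ^ 2 := fun i p => by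
    simp only [Pi.add_apply]; ring
  simp only [hexp]
  have h12 : ∀ i, Integrable (fun p : Ω × (ι → ℝ) => g p.1 i ^ 2 + 2 * (g p.1 i * p.2 i))
      (ν.prod γ) := fun i => (h1 i).add ((h2 i).const_mul 2)
  have h123 : ∀ i, Integrable (fun p : Ω × (ι → ℝ) =>
      g p.1 i ^ 2 + 2 * (g p.1 i * p.2 i) + p.2 i ^ 2) (ν.prod γ) := fun i => (h12 i).add (h3 i)
  refine ⟨integrable_finsetSum _ fun i _ => h123 i, ?_⟩
  rw [integral_finsetSum _ fun i _ => h123 i, Fintype.card_eq_sum_ones]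
  push_cast
  rw [← Finset.sum_add_distrib]
  refine Finset.sum_congr rfl fun i _ => ?_
  have e0 : ∫ z, z i ∂γ = 0 := by
    rw [hγ, integral_comp_eval (μ := fun _ : ι => gaussianReal 0 1) (f := fun x : ℝ => x)
      (by fun_prop)]
    exact integral_id_gaussianReal
  have e1 : ∫ z, z i ^ 2 ∂γ = 1 := by
    rw [hγ, integral_comp_eval (μ := fun _ : ι => gaussianReal 0 1) (f := fun x : ℝ => x ^ 2)
      (by fun_prop), integral_sq_gaussianReal]
    rfl
  rw [integral_add (h12 i) (h3 i), integral_add (h1 i) ((h2 i).const_mul 2), integral_const_mul,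
    integral_prod_mul (fun s => g s i) (fun z : ι → ℝ => z i), e0,
    integral_fun_fst (fun s => g s i ^ 2), integral_fun_snd (fun z : ι → ℝ => z i ^ 2), e1]
  simp

end SecondMoments

namespace HelperChannel

variable (W : HelperChannel) (n : ℕ)

theorem measurePreserving_stateLaw_eval (j : Fin 2) (i : Fin n) :
    MeasurePreserving (fun s : Fin 2 → Fin n → ℝ => s j i) (W.stateLaw n)
      (gaussianReal 0 (W.Q j)) :=
  (measurePreserving_eval (fun _ : Fin n => gaussianReal 0 (W.Q j)) i).comp
    (measurePreserving_eval (fun k => Measure.pi fun _ : Fin n => gaussianReal 0 (W.Q k)) j)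

theorem memLp_state (j : Fin 2) (i : Fin n) :
    MemLp (fun s : Fin 2 → Fin n → ℝ => s j i) 2 (W.stateLaw n) :=
  (memLp_two_gaussianReal _).comp_measurePreserving (W.measurePreserving_stateLaw_eval n j i)

theorem integral_state_sq (j : Fin 2) (i : Fin n) : ∫ s, s j i ^ 2 ∂(W.stateLaw n) = W.Q j := by
  rw [← integral_sq_gaussianReal, ← (W.measurePreserving_stateLaw_eval n j i).map_eq,
    integral_map (W.measurePreserving_stateLaw_eval n j i).aemeasurable (by fun_prop)]

theorem integral_state_mul_state (i : Fin n) : ∫ s, s 0 i * s 1 i ∂(W.stateLaw n) = 0 := by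
  have h := measurePreserving_piFinTwo
    fun k => Measure.pi fun _ : Fin n => gaussianReal 0 (W.Q k)
  have h2 := h.integral_comp (MeasurableEquiv.measurableEmbedding _)
    (fun p : (Fin n → ℝ) × (Fin n → ℝ) => p.1 i * p.2 i)
  refine h2.trans ?_
  rw [integral_prod_mul (fun x : Fin n → ℝ => x i) (fun x : Fin n → ℝ => x i),
    integral_comp_eval (μ := fun _ : Fin n => gaussianReal 0 (W.Q 0)) (f := fun x : ℝ => x)
      (by fun_prop)]
  have : ∫ x : ℝ, x ∂(gaussianReal 0 (W.Q 0)) = 0 := integral_id_gaussianReal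
  rw [this, zero_mul]

variable {n}

/-- Energy of a linear combination of the helper signal and the two states. -/
theorem sum_integral_sq_linear {X : (Fin 2 → Fin n → ℝ) → Fin n → ℝ}
    (hX : ∀ i, MemLp (fun s => X s i) 2 (W.stateLaw n)) (β : ℝ) (α : Fin 2 → ℝ) :
    ∑ i, ∫ s, (β * X s i + ∑ j, α j * s j i) ^ 2 ∂(W.stateLaw n) =
      β ^ 2 * ∑ i, ∫ s, X s i ^ 2 ∂(W.stateLaw n) +
      2 * β * ∑ j, α j * ∑ i, ∫ s, X s i * s j i ∂(W.stateLaw n) +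
      n * ∑ j, α j ^ 2 * (W.Q j : ℝ) := by
  have hper : ∀ i, ∫ s, (β * X s i + ∑ j, α j * s j i) ^ 2 ∂(W.stateLaw n) =
      β ^ 2 * ∫ s, X s i ^ 2 ∂(W.stateLaw n) +
      2 * β * (α 0 * ∫ s, X s i * s 0 i ∂(W.stateLaw n)) +
      2 * β * (α 1 * ∫ s, X s i * s 1 i ∂(W.stateLaw n)) +
      ∑ j, α j ^ 2 * (W.Q j : ℝ) := fun i => by
    have i1 := ((hX i).integrable_sq).const_mul (β ^ 2)
    have i2 := fun j => (((hX i).integrable_mul (W.memLp_state n j i)).const_mul (α j)).const_mul (2 * β)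
    have i3 := fun j => ((W.memLp_state n j i).integrable_sq).const_mul (α j ^ 2)
    have i4 := (((W.memLp_state n 0 i).integrable_mul (W.memLp_state n 1 i))).const_mul (2 * α 0 * α 1)
    simp only [Pi.mul_apply] at i2 i4
    have e : ∀ s : Fin 2 → Fin n → ℝ, (β * X s i + ∑ j, α j * s j i) ^ 2 =
        β ^ 2 * X s i ^ 2 + 2 * β * (α 0 * (X s i * s 0 i)) + 2 * β * (α 1 * (X s i * s 1 i)) +
        α 0 ^ 2 * s 0 i ^ 2 + α 1 ^ 2 * s 1 i ^ 2 + 2 * α 0 * α 1 * (s 0 i * s 1 i) := fun s => by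
      rw [Fin.sum_univ_two]; ring
    simp only [e]
    rw [integral_add (by fun_prop) i4, integral_add (by fun_prop) (i3 1),
      integral_add (by fun_prop) (i3 0), integral_add (by fun_prop) (i2 1),
      integral_add i1 (i2 0)]
    simp only [integral_const_mul, integral_state_sq, integral_state_mul_state, Fin.sum_univ_two]
    ring
  rw [Finset.sum_congr rfl fun i _ => hper i]
  simp only [Finset.sum_add_distrib, ← Finset.mul_sum, Finset.sum_const, Finset.card_univ,
    Fintype.card_fin, nsmul_eq_mul, Fin.sum_univ_two]
  ring

end HelperChannel

/-! ### Correlations and codeword energies -/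

/-- Correlation coefficients from the nonnegativity of a quadratic form. -/
theorem exists_correlation {p P₀ : ℝ} {c Q : Fin 2 → ℝ} (hQ : ∀ j, 0 ≤ Q j) (hp : p ≤ P₀)
    (h : ∀ α : Fin 2 → ℝ, 0 ≤ p + 2 * ∑ j, α j * c j + ∑ j, α j ^ 2 * Q j) :
    ∃ ρ b : Fin 2 → ℝ, ρ 0 ^ 2 + ρ 1 ^ 2 ≤ 1 ∧ (∀ j, c j = ρ j * √(P₀ * Q j)) ∧
      (∀ j, c j = b j * Q j) ∧ ∀ j, b j ^ 2 * Q j = ρ j ^ 2 * P₀ := by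
  have hc : ∀ j, c j = c j / Q j * Q j := fun j => by
    rcases eq_or_ne (Q j) 0 with h0 | h0
    · rw [h0, mul_zero]
      by_contra hne
      -- Without a quadratic term the form is affine in `α j`; this value makes it equal to `-1`.
      have := h (Pi.single j (-(p + 1) / (2 * c j)))
      have e1 : ∑ i, (Pi.single j (-(p + 1) / (2 * c j)) : Fin 2 → ℝ) i * c i = -(p + 1) / 2 := by
        rw [Finset.sum_eq_single j (fun i _ hi => by simp [hi]) (by simp), Pi.single_eq_same]
        field_simp
      have e2 : ∑ i, (Pi.single j (-(p + 1) / (2 * c j)) : Fin 2 → ℝ) i ^ 2 * Q i = 0 := by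
        rw [Finset.sum_eq_single j (fun i _ hi => by simp [hi]) (by simp), h0, mul_zero]
      rw [e1, e2] at this
      linarith
    · field_simp
  -- Regression coefficients on the states. For `Q j = 0` the quotient is `0`, consistent with `c j
  -- = 0`. Evaluating the form at `-b` gives Bessel's inequality.
  set b : Fin 2 → ℝ := fun j => c j / Q j with hb
  have hbes : b 0 ^ 2 * Q 0 + b 1 ^ 2 * Q 1 ≤ p := by
    have := h fun j => -b j
    simp only [Fin.sum_univ_two] at this
    have h0 : c 0 = b 0 * Q 0 := hc 0
    have h1 : c 1 = b 1 * Q 1 := hc 1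
    rw [h0, h1] at this
    nlinarith
  have hb0 : ∀ j, 0 ≤ b j ^ 2 * Q j := fun j => mul_nonneg (sq_nonneg _) (hQ j)
  have hbP : ∀ j, b j ^ 2 * Q j ≤ P₀ := by
    have := hb0 0
    have := hb0 1
    rw [Fin.forall_fin_two]
    constructor <;> linarith
  have hP₀ : 0 ≤ P₀ := (hb0 0).trans (hbP 0)
  rcases hP₀.eq_or_lt with h0 | h0
  · have hz : ∀ j, b j ^ 2 * Q j = 0 := fun j => le_antisymm (h0 ▸ hbP j) (hb0 j)
    refine ⟨0, b, by simp, fun j => ?_, hc, fun j => by simp [hz j]⟩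
    rw [Pi.zero_apply, zero_mul, hc j]
    rcases mul_eq_zero.mp (hz j) with h2 | h2
    · rw [pow_eq_zero_iff two_ne_zero] at h2
      change b j * Q j = 0
      rw [h2, zero_mul]
    · rw [h2, mul_zero]
  · have hs : √P₀ ≠ 0 := (Real.sqrt_pos.mpr h0).ne'
    have hsq : ∀ j, (b j * √(Q j) / √P₀) ^ 2 = b j ^ 2 * Q j / P₀ := fun j => by
      rw [div_pow, mul_pow, Real.sq_sqrt (hQ j), Real.sq_sqrt h0.le]
    -- Normalising by `P₀` instead of `p` keeps `ρ` in the disc because `p ≤ P₀`.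
    refine ⟨fun j => b j * √(Q j) / √P₀, b, ?_, fun j => ?_, hc, fun j => ?_⟩
    · simp only [hsq]
      rw [← add_div, div_le_one h0]
      linarith
    · rw [hc j, Real.sqrt_mul h0.le]
      change b j * Q j = _
      field_simp
      rw [Real.sq_sqrt (hQ j)]
    · simp only [hsq]
      field_simp

/-- Codewords centred at their mean, added to an independent signal: the energies add up. -/
theorem sum_integral_sq_centered_le {Ω : Type*} [MeasurableSpace Ω] {ν : Measure Ω}
    [IsProbabilityMeasure ν] {n M : ℕ} (hM : 0 < M) (x : Fin M → Fin n → ℝ) {u : Ω → Fin n → ℝ}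
    (hu : ∀ i, MemLp (fun s => u s i) 2 ν) :
    ∑ m, ∑ i, ∫ s, (x m + u s - fun i => (∑ m', x m' i) / M) i ^ 2 ∂ν ≤
      M * ∑ i, ∫ s, u s i ^ 2 ∂ν + ∑ m, ∑ i, x m i ^ 2 := by
  have hM' : (M : ℝ) ≠ 0 := by positivity
  rw [Finset.sum_comm, Finset.sum_comm (f := fun m i => x m i ^ 2), Finset.mul_sum,
    ← Finset.sum_add_distrib]
  refine Finset.sum_le_sum fun i _ => ?_
  set t := (∑ m', x m' i) / M with ht
  have hsum : ∑ m, x m i = M * t := by rw [ht]; field_simp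
  have h1 : ∀ m, ∫ s, (x m + u s - fun i => (∑ m', x m' i) / M) i ^ 2 ∂ν =
      ∫ s, u s i ^ 2 ∂ν + 2 * (∫ s, u s i ∂ν) * (x m i - t) + (x m i - t) ^ 2 := fun m => by
    have e : ∀ s, (x m + u s - fun i => (∑ m', x m' i) / M) i ^ 2 =
        u s i ^ 2 + 2 * (x m i - t) * u s i + (x m i - t) ^ 2 := fun s => by
      simp only [Pi.sub_apply, Pi.add_apply, ← ht]; ring
    simp only [e]
    have i1 := (hu i).integrable_sq
    have i2 := ((hu i).integrable one_le_two).const_mul (2 * (x m i - t))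
    rw [integral_add (by fun_prop) (integrable_const _), integral_add i1 i2, integral_const_mul]
    simp only [integral_const, probReal_univ, one_smul]
    ring
  simp only [h1, Finset.sum_add_distrib, ← Finset.mul_sum, Finset.sum_sub_distrib, sub_sq, hsum,
    Finset.sum_const, Finset.card_univ, Fintype.card_fin, nsmul_eq_mul]
  -- Centring makes the cross term with the mean of `u` vanish in the sum over `m`, so `u` may have
  -- nonzero mean; the gain `M * t ^ 2` is discarded.
  have h2 : ∑ m, 2 * x m i * t = 2 * (M * t) * t := by
    rw [← Finset.sum_mul, ← Finset.mul_sum, hsum]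
  rw [h2]
  have : 0 ≤ (M : ℝ) * t ^ 2 := by positivity
  nlinarith

/-! ### The two single-receiver converses -/

/-- Converse with the states revealed to the receiver. -/
theorem log_card_le_of_known_state {Ω : Type*} [MeasurableSpace Ω] {ν : Measure Ω}
    [IsProbabilityMeasure ν] {n M : ℕ} {u : Ω → Fin n → ℝ} (hu : Measurable u)
    (hM : 0 < M) {x : Fin M → Fin n → ℝ} {p : ℝ≥0}
    (hx : ∑ m, ∑ i, x m i ^ 2 ≤ M * (n * p)) {D : Fin M → Set (Fin n → ℝ)}
    (hD : ∀ m, MeasurableSet (D m)) (hdisj : Pairwise (Function.onFun Disjoint D)) :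
    Real.log M * ∑ m, (ν.prod (Measure.pi fun _ : Fin n => gaussianReal 0 1)).real
      ((fun q => x m + (u q.1 + q.2)) ⁻¹' D m) ≤
      M * (1 + n / 2 * Real.log (1 + p)) := by
  set t : Fin n → ℝ := fun i => (∑ m', x m' i) / M with ht
  have hτ : 1 + p ≠ 0 := by positivity
  have hτ' : (0 : ℝ) < 1 + p := by positivity
  set K : ℝ := n / 2 * Real.log (1 + p) with hK
  let L : Fin M → Ω × (Fin n → ℝ) → ℝ := fun m q =>
    Real.log (piGaussianPDF (1 + p) (x m + q.2 - t)) - Real.log (piGaussianPDF 1 q.2)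
  -- The log-likelihood ratio is a constant plus quadratic forms, so only second moments enter its
  -- mean. The constant `K` is the bound sought; the quadratic forms must average to at most zero.
  have hLeq : ∀ m q, -L m q = K + (1 / (2 * (1 + p)) * ∑ i, ((x m - t) + q.2) i ^ 2 -
      1 / 2 * ∑ i, ((0 : Fin n → ℝ) + q.2) i ^ 2) := fun m q => by
    simp only [L]
    rw [log_piGaussianPDF hτ, log_piGaussianPDF one_ne_zero,
      show x m + q.2 - t = (x m - t) + q.2 by abel, zero_add, hK]
    push_cast
    rw [Real.log_mul (by positivity) hτ'.ne', mul_one, Fintype.card_fin]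
    ring
  have hLm : ∀ m, Measurable (L m) := fun m => by fun_prop
  have I1 := fun m => integrable_sq_add_noise (ν := ν) (g := fun _ => x m - t)
    fun i => memLp_const _
  have I2 := integrable_sq_add_noise (ν := ν) (g := fun _ => (0 : Fin n → ℝ))
    fun i => memLp_const _
  have J1 := fun m => (I1 m).1.const_mul (1 / (2 * (1 + (p : ℝ))))
  have J2 := I2.1.const_mul (1 / 2)
  have hLi : ∀ m, Integrable (L m)
      (ν.prod (Measure.pi fun _ : Fin n => gaussianReal 0 1)) := fun m => by
    refine ((integrable_const K).add ((J1 m).sub J2)).neg.congr (ae_of_all _ fun q => ?_)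
    exact neg_eq_iff_eq_neg.mpr (hLeq m q).symm
  have hval : ∀ m, ∫ q, -L m q ∂(ν.prod (Measure.pi fun _ : Fin n => gaussianReal 0 1)) =
      K + (1 / (2 * (1 + p)) * (∑ i, ∫ _, (x m - t) i ^ 2 ∂ν + n) - 1 / 2 * n) := fun m => by
    simp only [hLeq]
    refine (integral_add (integrable_const K) ((J1 m).sub J2)).trans ?_
    rw [integral_sub' (J1 m) J2]
    simp only [integral_const_mul]
    rw [(I1 m).2, I2.2]
    simp
  have hκ : IsProbabilityMeasure ((ν.prod (Measure.pi fun _ : Fin n => gaussianReal 0 (1 + p))).map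
      (fun q => q.2 + t + u q.1)) := Measure.isProbabilityMeasure_map (by fun_prop)
  have hYm : ∀ m, Measurable fun q : Ω × (Fin n → ℝ) => x m + (u q.1 + q.2) :=
    fun m => by fun_prop
  refine (log_mul_sum_measureReal_le _ _ hM hLm hLi hYm
    (fun m => map_withDensity_of_known_state ν hτ hu (x m) t) hD hdisj).trans ?_
  simp only [hval]
  clear_value K
  have hc := sum_integral_sq_centered_le (ν := ν) hM x (u := fun _ => 0) fun i => memLp_const _
  rw [← ht] at hc
  simp only [add_zero, Pi.zero_apply, ne_eq, OfNat.ofNat_ne_zero, not_false_eq_true, zero_pow,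
    integral_zero, Finset.sum_const_zero, mul_zero, zero_add] at hc
  rw [Finset.sum_add_distrib, Finset.sum_sub_distrib, ← Finset.mul_sum, Finset.sum_add_distrib]
  simp only [Finset.sum_const, Finset.card_univ, Fintype.card_fin, nsmul_eq_mul]
  have h2 := mul_le_mul_of_nonneg_left (hc.trans hx) (show 0 ≤ 1 / (2 * (1 + (p : ℝ))) by positivity)
  have e : 1 / (2 * (1 + (p : ℝ))) * (M * (n * p)) + 1 / (2 * (1 + (p : ℝ))) * (M * n) =
      M * (1 / 2 * n) := by field_simp; ring
  rw [mul_add (1 / (2 * (1 + (p : ℝ))))]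
  linarith

namespace HelperChannel

variable (W : HelperChannel) {n M : ℕ}

/-- Converse for a receiver that does not know the states. The interference `u` is compared with
`∑ j, a j * S j + N(0, B)`, of variance `A`; both error variances may fall short by `δ`. -/
theorem log_card_le_of_unknown_state {u : (Fin 2 → Fin n → ℝ) → Fin n → ℝ} (hu : Measurable u)
    (hu2 : ∀ i, MemLp (fun s => u s i) 2 (W.stateLaw n))
    (hM : 0 < M) {x : Fin M → Fin n → ℝ} {p : ℝ≥0}
    (hx : ∑ m, ∑ i, x m i ^ 2 ≤ M * (n * p)) {D : Fin M → Set (Fin n → ℝ)}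
    (hD : ∀ m, MeasurableSet (D m)) (hdisj : Pairwise (Function.onFun Disjoint D))
    {A B : ℝ≥0} (hB : B ≠ 0) (a : Fin 2 → ℝ)
    (hAB : A = ∑ j, NNReal.mk (a j ^ 2) (sq_nonneg _) * W.Q j + B) {δ : ℝ} (hδ : 0 ≤ δ)
    (hA' : ∑ i, ∫ s, u s i ^ 2 ∂(W.stateLaw n) + n = n * (A - δ))
    (hB' : ∑ i, ∫ s, (u s - fun i => ∑ j, a j * s j i) i ^ 2 ∂(W.stateLaw n) + n =
      n * (B - δ)) :
    Real.log M * ∑ m, ((W.stateLaw n).prod (Measure.pi fun _ : Fin n => gaussianReal 0 1)).real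
      ((fun q => x m + (u q.1 + q.2)) ⁻¹' D m) ≤
      M * (1 + n / 2 * (Real.log (A + p) - Real.log A + Real.log B)) := by
  set t : Fin n → ℝ := fun i => (∑ m', x m' i) / M with ht
  have hBA : B ≤ A := by rw [hAB]; exact le_add_self
  have hBpos : 0 < B := pos_iff_ne_zero.mpr hB
  have hA : A ≠ 0 := (hBpos.trans_le hBA).ne'
  have hτ : A + p ≠ 0 := by positivity
  have hB0 : (0 : ℝ) < B := by exact_mod_cast hBpos
  have hBA' : (B : ℝ) ≤ A := by exact_mod_cast hBA
  have hA0 : (0 : ℝ) < A := hB0.trans_le hBA'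
  have hτ0 : (0 : ℝ) < A + p := by positivity
  set K : ℝ := n / 2 * (Real.log (A + p) - Real.log A + Real.log B) with hK
  let L : Fin M → (Fin 2 → Fin n → ℝ) × (Fin n → ℝ) → ℝ := fun m q =>
    Real.log (piGaussianPDF B (u q.1 + q.2 - fun i => ∑ j, a j * q.1 j i))
      + Real.log (piGaussianPDF (A + p) (x m + (u q.1 + q.2) - t))
      - Real.log (piGaussianPDF A (u q.1 + q.2)) - Real.log (piGaussianPDF 1 q.2)
  have hLeq : ∀ m q, -L m q =
      K + (1 / (2 * B) * ∑ i, ((u q.1 - fun i => ∑ j, a j * q.1 j i) + q.2) i ^ 2 +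
        1 / (2 * (A + p)) * ∑ i, ((x m + u q.1 - t) + q.2) i ^ 2 -
        1 / (2 * A) * ∑ i, (u q.1 + q.2) i ^ 2 -
        1 / 2 * ∑ i, ((0 : Fin n → ℝ) + q.2) i ^ 2) := fun m q => by
    simp only [L]
    rw [log_piGaussianPDF hτ, log_piGaussianPDF hA, log_piGaussianPDF hB,
      log_piGaussianPDF one_ne_zero, zero_add, hK, add_sub_right_comm (u q.1) q.2,
      show x m + (u q.1 + q.2) - t = x m + u q.1 - t + q.2 by abel]
    push_cast
    rw [Real.log_mul (by positivity) hτ0.ne', Real.log_mul (by positivity) hA0.ne',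
      Real.log_mul (by positivity) hB0.ne', mul_one, Fintype.card_fin]
    ring
  have hLm : ∀ m, Measurable (L m) := fun m => by fun_prop
  have I1 := integrable_sq_add_noise (ν := W.stateLaw n)
    (g := fun s => u s - fun i => ∑ j, a j * s j i) fun i =>
      (hu2 i).sub (memLp_finsetSum _ fun j _ => (W.memLp_state n j i).const_mul (a j))
  have I2 := fun m => integrable_sq_add_noise (ν := W.stateLaw n) (g := fun s => x m + u s - t)
    fun i => ((memLp_const (x m i)).add (hu2 i)).sub (memLp_const (t i))
  have I3 := integrable_sq_add_noise (ν := W.stateLaw n) (g := u) hu2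
  have I4 := integrable_sq_add_noise (ν := W.stateLaw n) (g := fun _ => (0 : Fin n → ℝ))
    fun i => memLp_const _
  have J1 := I1.1.const_mul (1 / (2 * (B : ℝ)))
  have J2 := fun m => (I2 m).1.const_mul (1 / (2 * ((A : ℝ) + p)))
  have J3 := I3.1.const_mul (1 / (2 * (A : ℝ)))
  have J4 := I4.1.const_mul (1 / 2)
  have hLi : ∀ m, Integrable (L m)
      ((W.stateLaw n).prod (Measure.pi fun _ : Fin n => gaussianReal 0 1)) := fun m => by
    refine ((integrable_const K).add ((((J1.add (J2 m)).sub J3)).sub J4)).neg.congr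
      (ae_of_all _ fun q => ?_)
    exact neg_eq_iff_eq_neg.mpr (hLeq m q).symm
  have hval : ∀ m,
      ∫ q, -L m q ∂((W.stateLaw n).prod (Measure.pi fun _ : Fin n => gaussianReal 0 1)) =
        K + (1 / (2 * B) * (n * (B - δ)) + 1 / (2 * (A + p)) *
          (∑ i, ∫ s, (x m + u s - t) i ^ 2 ∂(W.stateLaw n) + n) -
          1 / (2 * A) * (n * (A - δ)) - 1 / 2 * n) := fun m => by
    simp only [hLeq]
    refine (integral_add (integrable_const K) (((J1.add (J2 m)).sub J3).sub J4)).trans ?_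
    rw [integral_sub' ((J1.add (J2 m)).sub J3) J4, integral_sub' (J1.add (J2 m)) J3,
      integral_add' J1 (J2 m)]
    simp only [integral_const_mul]
    rw [I1.2, (I2 m).2, I3.2, I4.2, Fintype.card_fin, hA', hB']
    simp
  have hκ : IsProbabilityMeasure
      ((Measure.pi fun _ : Fin n => gaussianReal 0 (A + p)).map (fun w => w + t)) :=
    Measure.isProbabilityMeasure_map (by fun_prop)
  have hYm : ∀ m, Measurable fun q : (Fin 2 → Fin n → ℝ) × (Fin n → ℝ) => x m + (u q.1 + q.2) :=
    fun m => by fun_prop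
  refine (log_mul_sum_measureReal_le _ _ hM hLm hLi hYm
    (fun m => W.map_withDensity_of_unknown_state n hA hB hτ a hAB hu (x m) t) hD hdisj).trans ?_
  simp only [hval]
  clear_value K
  have hc := (sum_integral_sq_centered_le (ν := W.stateLaw n) hM x hu2).trans
    (add_le_add_right hx _)
  rw [← ht] at hc
  rw [Finset.sum_add_distrib, Finset.sum_sub_distrib, Finset.sum_sub_distrib,
    Finset.sum_add_distrib, ← Finset.mul_sum _ _ (1 / (2 * ((A : ℝ) + p))), Finset.sum_add_distrib]
  simp only [Finset.sum_const, Finset.card_univ, Fintype.card_fin, nsmul_eq_mul]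
  -- The output energy averaged over the messages is at most `n * (A + p - δ)`: it inherits the
  -- deficit `δ` of the interference.
  have h2 : 1 / (2 * ((A : ℝ) + p)) * (∑ m, ∑ i, ∫ s, (x m + u s - t) i ^ 2 ∂(W.stateLaw n) + M * n) ≤
      1 / (2 * ((A : ℝ) + p)) * (M * (n * (A + p - δ))) := by
    refine mul_le_mul_of_nonneg_left ?_ (by positivity)
    have e : (∑ i, ∫ s, u s i ^ 2 ∂(W.stateLaw n)) = n * (A - δ) - n := by linarith
    rw [e] at hc
    linarith
  have e1 : 1 / (2 * ((A : ℝ) + p)) * (M * (n * (A + p - δ))) =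
      M * n * (1 / 2 - δ * (1 / (2 * (A + p)))) := by field_simp
  have e2 : M * (1 / (2 * (B : ℝ)) * (n * (B - δ))) = M * n * (1 / 2 - δ * (1 / (2 * B))) := by
    field_simp
  have e3 : M * (1 / (2 * (A : ℝ)) * (n * (A - δ))) = M * n * (1 / 2 - δ * (1 / (2 * A))) := by
    field_simp
  -- The deficit raises the bound only through the term in `A`, which enters with a minus sign;
  -- since `B ≤ A` the term in `B` more than compensates.
  have h3 : δ * (1 / (2 * (A : ℝ))) ≤ δ * (1 / (2 * B)) := by gcongr
  have h4 : 0 ≤ δ * (1 / (2 * ((A : ℝ) + p))) := by positivity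
  have h5 : 0 ≤ (M : ℝ) * n * (δ * (1 / (2 * (B : ℝ))) + δ * (1 / (2 * ((A : ℝ) + p))) -
      δ * (1 / (2 * (A : ℝ)))) := mul_nonneg (by positivity) (by linarith)
  rw [e1] at h2
  rw [e2, e3]
  linarith

end HelperChannel

/-! ### From codes to conditional laws and energies -/

theorem lintegral_uniformOn_univ {M : ℕ} (f : Fin M → ℝ≥0∞) :
    ∫⁻ m, f m ∂(uniformOn Set.univ) = (∑ m, f m) / M := by
  rw [lintegral_fintype, div_eq_mul_inv, Finset.sum_mul]
  refine Finset.sum_congr rfl fun m _ => ?_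
  rw [uniformOn_univ]
  simp

namespace HelperChannel

variable (W : HelperChannel) {n : ℕ} {M : Fin 2 → ℕ}

theorem isProbabilityMeasure_uniformOn_fin {N : ℕ} (hN : 0 < N) :
    IsProbabilityMeasure (uniformOn (Set.univ : Set (Fin N))) :=
  have : Nonempty (Fin N) := ⟨⟨0, hN⟩⟩
  isProbabilityMeasure_uniformOn Set.finite_univ Set.univ_nonempty

theorem measurePreserving_messageLaw_eval (hM : ∀ k, 0 < M k) (k : Fin 2) :
    MeasurePreserving (fun m : ∀ k, Fin (M k) => m k) (messageLaw M) (uniformOn Set.univ) :=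
  have := fun k => isProbabilityMeasure_uniformOn_fin (hM k)
  measurePreserving_eval (fun k => uniformOn (Set.univ : Set (Fin (M k)))) k

/-- Law of the message, the states and the noise that matter to receiver `k`. -/
theorem measurePreserving_jointLaw (hM : ∀ k, 0 < M k) (k : Fin 2) :
    MeasurePreserving (fun ω : (∀ k, Fin (M k)) × (Fin 2 → Fin n → ℝ) × (Fin 2 → Fin n → ℝ) =>
      (ω.1 k, ω.2.1, ω.2.2 k)) (W.jointLaw n M)
      ((uniformOn Set.univ).prod
        ((W.stateLaw n).prod (Measure.pi fun _ : Fin n => gaussianReal 0 1))) := by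
  have := fun k => isProbabilityMeasure_uniformOn_fin (hM k)
  have : IsProbabilityMeasure (messageLaw M) := by unfold messageLaw; infer_instance
  have : IsProbabilityMeasure (noiseLaw n) := by unfold noiseLaw; infer_instance
  have h : MeasurePreserving (fun z : Fin 2 → Fin n → ℝ => z k) (noiseLaw n)
      (Measure.pi fun _ : Fin n => gaussianReal 0 1) :=
    measurePreserving_eval (fun _ : Fin 2 => Measure.pi fun _ : Fin n => gaussianReal 0 1) k
  exact (measurePreserving_messageLaw_eval hM k).prod ((MeasurePreserving.id _).prod h)

theorem isProbabilityMeasure_jointLaw (hM : ∀ k, 0 < M k) :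
    IsProbabilityMeasure (W.jointLaw n M) := by
  have := fun k => isProbabilityMeasure_uniformOn_fin (hM k)
  have : IsProbabilityMeasure (messageLaw M) := by unfold messageLaw; infer_instance
  have : IsProbabilityMeasure (noiseLaw n) := by unfold noiseLaw; infer_instance
  unfold jointLaw
  infer_instance

/-- Interference seen by receiver `k`. -/
def interference (c : HelperCode n M) (k : Fin 2) (s : Fin 2 → Fin n → ℝ) : Fin n → ℝ :=
  fun i => W.η k * c.helper s i + s k i

theorem measurable_interference (c : HelperCode n M) (k : Fin 2) :
    Measurable (W.interference c k) := by
  have := c.measurable_helper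
  unfold interference
  fun_prop

/-- If no message is decoded wrongly then in particular message `k` is decoded correctly. Uniformity
of the message turns the probability of the latter into an average over the codebook, with the
states and noise `k` as the only randomness. -/
theorem one_sub_errorProb_mul_le (c : HelperCode n M) (hM : ∀ k, 0 < M k) (k : Fin 2) :
    (1 - W.errorProb c) * M k ≤
      ∑ m, ((W.stateLaw n).prod (Measure.pi fun _ : Fin n => gaussianReal 0 1)).real
        ((fun q => c.enc k m + (W.interference c k q.1 + q.2)) ⁻¹' (c.dec k ⁻¹' {some m})) := by
  have := isProbabilityMeasure_uniformOn_fin (hM k)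
  have := W.isProbabilityMeasure_jointLaw (n := n) hM
  have hu := W.measurable_interference c k
  set P := (W.stateLaw n).prod (Measure.pi fun _ : Fin n => gaussianReal 0 1) with hP
  set S : Fin (M k) → Set ((Fin 2 → Fin n → ℝ) × (Fin n → ℝ)) := fun m =>
    (fun q => c.enc k m + (W.interference c k q.1 + q.2)) ⁻¹' (c.dec k ⁻¹' {some m}) with hS
  have hSm : ∀ m, MeasurableSet (S m) := fun m =>
    (show Measurable fun q : (Fin 2 → Fin n → ℝ) × (Fin n → ℝ) =>
      c.enc k m + (W.interference c k q.1 + q.2) by fun_prop) (c.measurableSet_dec k (some m))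
  set C : Set (Fin (M k) × (Fin 2 → Fin n → ℝ) × (Fin n → ℝ)) := ⋃ m, {m} ×ˢ S m with hC
  have hCm : MeasurableSet C := MeasurableSet.iUnion fun m => (measurableSet_singleton m).prod (hSm m)
  have hmem : ∀ m q, (m, q) ∈ C ↔ q ∈ S m := fun m q => by simp [hC]
  have hφ := W.measurePreserving_jointLaw (n := n) hM k
  have hCval : ((uniformOn Set.univ).prod P).real C * M k = ∑ m, P.real (S m) := by
    have h1 : ((uniformOn (Set.univ : Set (Fin (M k)))).prod P) C = (∑ m, P (S m)) / M k := by
      rw [Measure.prod_apply hCm, lintegral_uniformOn_univ]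
      congr 2
      ext m
      congr 1
      ext q
      exact hmem m q
    rw [measureReal_def, h1, ENNReal.toReal_div, ENNReal.toReal_sum fun _ _ => measure_ne_top _ _]
    have : (M k : ℝ) ≠ 0 := by exact_mod_cast (hM k).ne'
    simp only [ENNReal.toReal_natCast, measureReal_def]
    field_simp
  rw [← hCval, ← hφ.measureReal_preimage hCm.nullMeasurableSet]
  refine mul_le_mul_of_nonneg_right ?_ (Nat.cast_nonneg _)
  have hcover : (Set.univ : Set ((∀ k, Fin (M k)) × (Fin 2 → Fin n → ℝ) × (Fin 2 → Fin n → ℝ))) ⊆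
      {ω | ∃ k, c.dec k (W.output c k ω.1 ω.2.1 ω.2.2) ≠ some (ω.1 k)} ∪
      (fun ω => (ω.1 k, ω.2.1, ω.2.2 k)) ⁻¹' C := by
    intro ω _
    by_cases h : c.dec k (W.output c k ω.1 ω.2.1 ω.2.2) = some (ω.1 k)
    · right
      rw [Set.mem_preimage, hmem]
      have e : c.enc k (ω.1 k) + (W.interference c k ω.2.1 + ω.2.2 k) =
          W.output c k ω.1 ω.2.1 ω.2.2 := by
        ext i
        simp only [Pi.add_apply, interference, output]
        ring
      simp only [hS, Set.mem_preimage, e, h, Set.mem_singleton_iff]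
    · exact Or.inl ⟨k, h⟩
  have h1 := (measureReal_mono (μ := W.jointLaw n M) hcover).trans (measureReal_union_le _ _)
  rw [probReal_univ] at h1
  unfold errorProb
  linarith

/-- Total energy of the codebook of transmitter `k`. -/
theorem sum_sq_enc_le {c : HelperCode n M} (hc : W.PowerConstraint c) (hM : ∀ k, 0 < M k)
    (k : Fin 2) : ∑ m, ∑ i, c.enc k m i ^ 2 ≤ M k * (n * W.P k) := by
  have h := hc.2 k
  have h2 := (measurePreserving_messageLaw_eval hM k).lintegral_comp
    (f := fun m => ∑ i, ENNReal.ofReal (c.enc k m i ^ 2)) (measurable_of_finite _)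
  rw [h2, lintegral_uniformOn_univ] at h
  have hM0 : (M k : ℝ≥0∞) ≠ 0 := by exact_mod_cast (hM k).ne'
  rw [ENNReal.div_le_iff hM0 (ENNReal.natCast_ne_top _)] at h
  have e : ∀ m, ∑ i, ENNReal.ofReal (c.enc k m i ^ 2) = ENNReal.ofReal (∑ i, c.enc k m i ^ 2) :=
    fun m => (ENNReal.ofReal_sum_of_nonneg fun _ _ => sq_nonneg _).symm
  simp only [e] at h
  rw [← ENNReal.ofReal_sum_of_nonneg fun _ _ => Finset.sum_nonneg fun _ _ => sq_nonneg _] at h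
  have h3 := ENNReal.toReal_mono (by finiteness) h
  rw [ENNReal.toReal_ofReal (Finset.sum_nonneg fun _ _ => Finset.sum_nonneg fun _ _ => sq_nonneg _)]
    at h3
  simp only [ENNReal.toReal_mul, ENNReal.toReal_natCast, ENNReal.coe_toReal] at h3
  linarith

theorem memLp_helper {c : HelperCode n M} (hc : W.PowerConstraint c) (i : Fin n) :
    MemLp (fun s => c.helper s i) 2 (W.stateLaw n) := by
  have hm : Measurable fun s => c.helper s i := (measurable_pi_apply i).comp c.measurable_helper
  rw [memLp_two_iff_integrable_sq hm.aestronglyMeasurable]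
  refine ⟨by fun_prop, ?_⟩
  rw [hasFiniteIntegral_iff_ofReal (ae_of_all _ fun _ => sq_nonneg _)]
  refine lt_of_le_of_lt (lintegral_mono fun s => ?_)
    (hc.1.trans_lt (ENNReal.mul_lt_top (ENNReal.natCast_lt_top _) ENNReal.coe_lt_top))
  exact Finset.single_le_sum (f := fun i => ENNReal.ofReal (c.helper s i ^ 2))
    (fun _ _ => zero_le) (Finset.mem_univ i)

theorem sum_integral_sq_helper_le {c : HelperCode n M} (hc : W.PowerConstraint c) :
    ∑ i, ∫ s, c.helper s i ^ 2 ∂(W.stateLaw n) ≤ n * W.P₀ := by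
  have hi := fun i => (W.memLp_helper hc i).integrable_sq
  have h := ENNReal.toReal_mono (by finiteness) hc.1
  have e : ∀ s, ∑ i, ENNReal.ofReal (c.helper s i ^ 2) = ENNReal.ofReal (∑ i, c.helper s i ^ 2) :=
    fun s => (ENNReal.ofReal_sum_of_nonneg fun _ _ => sq_nonneg _).symm
  simp only [e] at h
  rw [← integral_eq_lintegral_of_nonneg_ae
    (ae_of_all _ fun _ => Finset.sum_nonneg fun _ _ => sq_nonneg _)
    (integrable_finsetSum _ fun i _ => hi i).aestronglyMeasurable,
    integral_finsetSum _ fun i _ => hi i] at h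
  simpa using h

end HelperChannel

/-! ### Finite block length converse for both receivers -/

namespace HelperChannel

variable (W : HelperChannel) {n : ℕ} {M : Fin 2 → ℕ}

/-- Variance of the interference plus noise at receiver `k` for correlations `ρ` of the helper
signal with the states. -/
noncomputable def noiseVar (k : Fin 2) (ρ : Fin 2 → ℝ) : ℝ :=
  W.η k ^ 2 * W.P₀ + 2 * W.η k * ρ k * √(W.P₀ * W.Q k) + W.Q k + 1

/-- Conditional variance of the interference plus noise at receiver `k` given the states. -/
noncomputable def condVar (k : Fin 2) (ρ : Fin 2 → ℝ) : ℝ :=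
  (1 - ρ 0 ^ 2 - ρ 1 ^ 2) * W.η k ^ 2 * W.P₀ + 1

theorem one_le_condVar (k : Fin 2) {ρ : Fin 2 → ℝ} (hρ : ρ 0 ^ 2 + ρ 1 ^ 2 ≤ 1) :
    1 ≤ W.condVar k ρ := by
  have h : 0 ≤ (1 - ρ 0 ^ 2 - ρ 1 ^ 2) * W.η k ^ 2 * W.P₀ :=
    mul_nonneg (mul_nonneg (by linarith) (sq_nonneg _)) W.P₀.coe_nonneg
  unfold condVar
  linarith

theorem one_le_noiseVar (k : Fin 2) {ρ : Fin 2 → ℝ} (hρ : ρ 0 ^ 2 + ρ 1 ^ 2 ≤ 1) :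
    1 ≤ W.noiseVar k ρ := by
  have hk : ρ k ^ 2 ≤ 1 := by
    have h0 := sq_nonneg (ρ 0)
    have h1 := sq_nonneg (ρ 1)
    revert k
    rw [Fin.forall_fin_two]
    constructor <;> linarith
  have h : 0 ≤ (1 - ρ k ^ 2) * (W.η k ^ 2 * W.P₀) :=
    mul_nonneg (by linarith) (mul_nonneg (sq_nonneg _) W.P₀.coe_nonneg)
  have hP := Real.sq_sqrt W.P₀.coe_nonneg
  have hQ := Real.sq_sqrt (W.Q k).coe_nonneg
  -- Completing the square: the noise variance is this square plus `(1 - ρ k ^ 2) * η k ^ 2 * P₀`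
  -- plus one.
  have h2 := sq_nonneg (W.η k * ρ k * √W.P₀ + √(W.Q k))
  have e : (W.η k * ρ k * √W.P₀ + √(W.Q k)) ^ 2 = W.η k ^ 2 * ρ k ^ 2 * W.P₀ +
      2 * W.η k * ρ k * (√W.P₀ * √(W.Q k)) + W.Q k := by
    rw [add_sq, mul_pow, mul_pow, hP, hQ]; ring
  unfold noiseVar
  rw [Real.sqrt_mul W.P₀.coe_nonneg]
  linarith

/-- Finite block length converse, with correlations that serve both receivers. -/
theorem exists_log_card_le (c : HelperCode n M) (hc : W.PowerConstraint c) (hn : 0 < n)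
    (hM : ∀ k, 0 < M k) :
    ∃ ρ : Fin 2 → ℝ, ρ 0 ^ 2 + ρ 1 ^ 2 ≤ 1 ∧ ∀ k,
      Real.log (M k) * (1 - W.errorProb c) ≤ 1 + n / 2 *
        (Real.log (W.noiseVar k ρ + W.P k) - Real.log (W.noiseVar k ρ) +
          Real.log (W.condVar k ρ)) ∧
      Real.log (M k) * (1 - W.errorProb c) ≤ 1 + n / 2 * Real.log (1 + W.P k) := by
  have hn0 : (0 : ℝ) < n := by exact_mod_cast hn
  set X := c.helper with hX
  have hX2 := W.memLp_helper hc
  set E := ∑ i, ∫ s, X s i ^ 2 ∂(W.stateLaw n) with hE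
  set C : Fin 2 → ℝ := fun j => ∑ i, ∫ s, X s i * s j i ∂(W.stateLaw n) with hC
  have hlin : ∀ (β : ℝ) (α : Fin 2 → ℝ),
      ∑ i, ∫ s, (β * X s i + ∑ j, α j * s j i) ^ 2 ∂(W.stateLaw n) =
        β ^ 2 * E + 2 * β * ∑ j, α j * C j + n * ∑ j, α j ^ 2 * (W.Q j : ℝ) :=
    W.sum_integral_sq_linear hX2
  have hEp : E ≤ n * W.P₀ := W.sum_integral_sq_helper_le hc
  obtain ⟨ρ, b, hρ, hcρ, hcb, hbρ⟩ := exists_correlation (p := E / n) (P₀ := W.P₀)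
    (c := fun j => C j / n) (Q := fun j => (W.Q j : ℝ)) (fun j => (W.Q j).coe_nonneg)
    (by rw [div_le_iff₀ hn0]; linarith) (fun α => by
      have h := hlin 1 α
      have h0 : 0 ≤ ∑ i, ∫ s, (1 * X s i + ∑ j, α j * s j i) ^ 2 ∂(W.stateLaw n) :=
        Finset.sum_nonneg fun i _ => integral_nonneg fun s => sq_nonneg _
      rw [h] at h0
      have h1 := div_nonneg h0 hn0.le
      refine h1.trans_eq ?_
      simp only [Fin.sum_univ_two]
      field_simp)
  refine ⟨ρ, hρ, fun k => ?_⟩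
  -- Helper power left unused, as seen at receiver `k`.
  set δ := W.η k ^ 2 * (W.P₀ - E / n) with hδ
  have hδ0 : 0 ≤ δ := mul_nonneg (sq_nonneg _) (by rw [sub_nonneg, div_le_iff₀ hn0]; linarith)
  have hCρ : ∀ j, C j = n * (ρ j * √(W.P₀ * W.Q j)) := fun j => by
    rw [← hcρ j]; field_simp
  have hCb : ∀ j, C j = n * (b j * W.Q j) := fun j => by
    rw [← hcb j]; field_simp
  have hB1 := W.one_le_condVar k hρ
  let B : ℝ≥0 := ⟨W.condVar k ρ, zero_le_one.trans hB1⟩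
  let e : Fin 2 → ℝ := Pi.single k 1
  have he : ∀ f : Fin 2 → ℝ, ∑ j, e j * f j = f k := fun f => by
    rw [Finset.sum_eq_single k (fun j _ hj => by simp [e, hj]) (by simp)]
    simp [e]
  have hee : ∀ j, e j ^ 2 = e j := fun j => by
    rcases eq_or_ne j k with h | h <;> simp [e, h]
  -- Regression coefficients of the interference `η k * X + S k` on the states; `e` picks out the
  -- state `S k`.
  let a : Fin 2 → ℝ := fun j => W.η k * b j + e j
  let A : ℝ≥0 := ∑ j, NNReal.mk (a j ^ 2) (sq_nonneg _) * W.Q j + B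
  have hBval : (B : ℝ) = W.condVar k ρ := rfl
  have hAval : (A : ℝ) = W.noiseVar k ρ := by
    have h1 : (A : ℝ) = ∑ j, a j ^ 2 * (W.Q j : ℝ) + W.condVar k ρ := by
      simp only [A, NNReal.coe_add, NNReal.coe_sum, NNReal.coe_mul, NNReal.coe_mk, hBval]
    have h2 : ∀ j, a j ^ 2 * (W.Q j : ℝ) = W.η k ^ 2 * (ρ j ^ 2 * W.P₀) +
        e j * (2 * W.η k * (ρ j * √(W.P₀ * W.Q j)) + W.Q j) := fun j => by
      rw [← hbρ j, ← hcρ j, hcb j]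
      linear_combination (W.Q j : ℝ) * hee j
    rw [h1]
    simp only [h2, Finset.sum_add_distrib]
    rw [he, Fin.sum_univ_two]
    simp only [noiseVar, condVar]
    ring
  have hu := W.measurable_interference c k
  have hu2 : ∀ i, MemLp (fun s => W.interference c k s i) 2 (W.stateLaw n) := fun i =>
    ((hX2 i).const_mul _).add (W.memLp_state n k i)
  have hA' : ∑ i, ∫ s, W.interference c k s i ^ 2 ∂(W.stateLaw n) + n = n * (A - δ) := by
    have h := hlin (W.η k) e
    have h1 : ∀ i (s : Fin 2 → Fin n → ℝ), W.interference c k s i =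
        W.η k * X s i + ∑ j, e j * s j i := fun i s => by rw [he fun j => s j i]; rfl
    simp only [h1]
    rw [h]
    simp only [hee]
    rw [he, he]
    rw [hCρ, hAval, hδ, noiseVar]
    field_simp
    ring
  have hB' : ∑ i, ∫ s, (W.interference c k s - fun i => ∑ j, a j * s j i) i ^ 2 ∂(W.stateLaw n) + n =
      n * (B - δ) := by
    have h := hlin (W.η k) fun j => -(W.η k * b j)
    -- The state `S k` cancels, and the residual is `η k` times that of the helper signal regressed
    -- on both states.
    have h1 : ∀ i (s : Fin 2 → Fin n → ℝ), (W.interference c k s - fun i => ∑ j, a j * s j i) i =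
        W.η k * X s i + ∑ j, -(W.η k * b j) * s j i := fun i s => by
      have := he fun j => s j i
      simp only [Fin.sum_univ_two] at this
      simp only [Pi.sub_apply, interference, a, Fin.sum_univ_two]
      linear_combination -this
    simp only [h1]
    rw [h]
    have h2 : ∑ j, -(W.η k * b j) * C j = -(n * W.η k * ((ρ 0 ^ 2 + ρ 1 ^ 2) * W.P₀)) := by
      rw [Fin.sum_univ_two, hCb, hCb]
      linear_combination (-(n * W.η k)) * (hbρ 0 + hbρ 1)
    have h3 : ∑ j, (-(W.η k * b j)) ^ 2 * (W.Q j : ℝ) = W.η k ^ 2 * ((ρ 0 ^ 2 + ρ 1 ^ 2) * W.P₀) := by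
      rw [Fin.sum_univ_two]
      linear_combination (W.η k ^ 2) * (hbρ 0 + hbρ 1)
    rw [h2, h3, hBval, hδ, condVar]
    field_simp
    ring
  have hD : ∀ m, MeasurableSet (c.dec k ⁻¹' {some m}) := fun m => c.measurableSet_dec k _
  have hdisj : Pairwise (Function.onFun Disjoint fun m => c.dec k ⁻¹' {some m}) :=
    fun m m' hne => Disjoint.preimage _ (by simpa using hne)
  have hx := W.sum_sq_enc_le hc hM k
  have hcorrect := W.one_sub_errorProb_mul_le c hM k
  have hM0 : (0 : ℝ) < M k := by exact_mod_cast hM k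
  have hlog : 0 ≤ Real.log (M k) := Real.log_natCast_nonneg _
  have hB0 : B ≠ 0 := fun h => by
    have : (B : ℝ) = 0 := by rw [h]; rfl
    linarith
  have key : ∀ r : ℝ, Real.log (M k) *
      ∑ m, ((W.stateLaw n).prod (Measure.pi fun _ : Fin n => gaussianReal 0 1)).real
        ((fun q => c.enc k m + (W.interference c k q.1 + q.2)) ⁻¹' (c.dec k ⁻¹' {some m})) ≤
      M k * r → Real.log (M k) * (1 - W.errorProb c) ≤ r := fun r hr => by
    have h := (mul_le_mul_of_nonneg_left hcorrect hlog).trans hr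
    refine le_of_mul_le_mul_left ?_ hM0
    linarith
  constructor
  · have h := W.log_card_le_of_unknown_state hu hu2 (hM k) hx hD hdisj hB0 a rfl hδ0 hA' hB'
    rw [hAval, hBval] at h
    exact key _ h
  · exact key _ (log_card_le_of_known_state hu (hM k) hx hD hdisj)

end HelperChannel

/-! ### Passage to the limit -/

theorem messageCount_pos {R : Fin 2 → ℝ} (hR : ∀ k, 0 ≤ R k) (n : ℕ) (k : Fin 2) :
    0 < HelperChannel.messageCount R n k :=
  Nat.floor_pos.mpr (Real.one_le_rpow one_le_two (mul_nonneg n.cast_nonneg (hR k)))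

/-- Rounding down a number that is at least one loses at most a factor of two, a constant that
vanishes after division by `n`. -/
theorem mul_log_two_sub_le_log_messageCount {R : Fin 2 → ℝ} (hR : ∀ k, 0 ≤ R k) (n : ℕ)
    (k : Fin 2) :
    n * R k * Real.log 2 - Real.log 2 ≤ Real.log (HelperChannel.messageCount R n k) := by
  have h1 : (1 : ℝ) ≤ HelperChannel.messageCount R n k := by exact_mod_cast messageCount_pos hR n k
  have h2 := Nat.lt_floor_add_one ((2 : ℝ) ^ ((n : ℝ) * R k))
  have h3 : (2 : ℝ) ^ ((n : ℝ) * R k) ≤ 2 * HelperChannel.messageCount R n k := by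
    unfold HelperChannel.messageCount at h1 ⊢
    linarith
  have h4 := Real.log_le_log (by positivity) h3
  rw [Real.log_rpow two_pos, Real.log_mul two_ne_zero (by linarith)] at h4
  linarith

/-- Passage to the limit in a finite block length converse. -/
theorem le_of_tendsto_converse {r l G : ℝ} {N : ℕ → ℕ} (hN : Tendsto N atTop atTop)
    (hN0 : ∀ i, 0 < N i) {ε logM g : ℕ → ℝ} (hε : Tendsto ε atTop (𝓝 0)) (hε1 : ∀ i, ε i ≤ 1)
    (hlog : ∀ i, N i * r - l ≤ logM i) (hg : Tendsto g atTop (𝓝 G))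
    (h : ∀ i, logM i * (1 - ε i) ≤ 1 + N i / 2 * g i) : r ≤ 1 / 2 * G := by
  have hinv : Tendsto (fun i => ((N i : ℝ))⁻¹) atTop (𝓝 0) :=
    (tendsto_inv_atTop_zero.comp tendsto_natCast_atTop_atTop).comp hN
  have h1 : Tendsto (fun i => (r - l * (N i : ℝ)⁻¹) * (1 - ε i)) atTop (𝓝 r) := by
    simpa using ((tendsto_const_nhds (x := r)).sub (hinv.const_mul l)).mul
      ((tendsto_const_nhds (x := (1 : ℝ))).sub hε)
  have h2 : Tendsto (fun i => (N i : ℝ)⁻¹ + 1 / 2 * g i) atTop (𝓝 (1 / 2 * G)) := by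
    simpa only [zero_add] using hinv.add (hg.const_mul (1 / 2))
  refine le_of_tendsto_of_tendsto' h1 h2 fun i => ?_
  have hpos : (0 : ℝ) < N i := by exact_mod_cast hN0 i
  have h3 := (mul_le_mul_of_nonneg_right (hlog i) (sub_nonneg.mpr (hε1 i))).trans (h i)
  refine le_of_mul_le_mul_left ?_ hpos
  have e1 : N i * ((r - l * (N i : ℝ)⁻¹) * (1 - ε i)) = (N i * r - l) * (1 - ε i) := by
    field_simp
  have e2 : N i * ((N i : ℝ)⁻¹ + 1 / 2 * g i) = 1 + N i / 2 * g i := by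
    field_simp
  rw [e1, e2]
  exact h3

theorem isCompact_sq_add_sq_le_one : IsCompact {ρ : Fin 2 → ℝ | ρ 0 ^ 2 + ρ 1 ^ 2 ≤ 1} := by
  refine Metric.isCompact_of_isClosed_isBounded
    (isClosed_le (by fun_prop) continuous_const) ?_
  refine (Metric.isBounded_closedBall (x := (0 : Fin 2 → ℝ)) (r := 1)).subset fun ρ hρ => ?_
  rw [mem_closedBall_zero_iff, pi_norm_le_iff_of_nonneg zero_le_one, Fin.forall_fin_two]
  simp only [Set.mem_ofPred_eq] at hρ
  simp only [Real.norm_eq_abs, abs_le_one_iff_mul_self_le_one]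
  constructor <;> nlinarith [sq_nonneg (ρ 0), sq_nonneg (ρ 1)]

theorem proposition1 (W : HelperChannel) (R : Fin 2 → ℝ) (hR : W.IsAchievable R) :
    ∃ ρ : Fin 2 → ℝ, ρ 0 ^ 2 + ρ 1 ^ 2 ≤ 1 ∧
      ∀ k : Fin 2, R k ≤ min
        (1 / 2 * Real.logb 2 (1 + (W.P k : ℝ) /
            (W.η k ^ 2 * (W.P₀ : ℝ) + 2 * W.η k * ρ k * √((W.P₀ : ℝ) * (W.Q k : ℝ))
              + (W.Q k : ℝ) + 1))
          + 1 / 2 * Real.logb 2 ((1 - ρ 0 ^ 2 - ρ 1 ^ 2) * W.η k ^ 2 * (W.P₀ : ℝ) + 1))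
        (1 / 2 * Real.logb 2 (1 + (W.P k : ℝ))) := by
  obtain ⟨hR0, c, hc, herr⟩ := hR
  have hM := messageCount_pos hR0
  -- The shift to `i + 1` avoids block length zero.
  choose r hr hconv using fun i : ℕ => W.exists_log_card_le (c (i + 1)) (hc _) i.succ_pos (hM _)
  obtain ⟨ρ, hρ, φ, hφ, hlim⟩ := isCompact_sq_add_sq_le_one.tendsto_subseq hr
  have hN : Tendsto (fun i => φ i + 1) atTop atTop :=
    (tendsto_add_atTop_nat 1).comp hφ.tendsto_atTop
  have hε1 : ∀ i, W.errorProb (c i) ≤ 1 := fun i => by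
    have := W.isProbabilityMeasure_jointLaw (n := i) (hM i)
    exact measureReal_le_one
  have hlog2 : 0 < Real.log 2 := Real.log_pos one_lt_two
  refine ⟨ρ, hρ, fun k => le_min ?_ ?_⟩
  · have hA := W.one_le_noiseVar k hρ
    have hB := W.one_le_condVar k hρ
    have hP := (W.P k).coe_nonneg
    have hAc : Continuous (W.noiseVar k) := by unfold HelperChannel.noiseVar; fun_prop
    have hBc : Continuous (W.condVar k) := by unfold HelperChannel.condVar; fun_prop
    have hAl := (hAc.tendsto ρ).comp hlim
    have hBl := (hBc.tendsto ρ).comp hlim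
    -- Both variances are at least one at the limit `ρ`, so the logarithms are continuous there.
    have hg := (((hAl.add_const (W.P k : ℝ)).log (by positivity)).sub
      (hAl.log (by positivity))).add (hBl.log (by positivity))
    have h := le_of_tendsto_converse (r := R k * Real.log 2) (l := Real.log 2) hN
      (fun i => Nat.succ_pos _) (herr.comp hN) (fun i => hε1 _)
      (fun i => by
        rw [← mul_assoc]
        exact mul_log_two_sub_le_log_messageCount hR0 (φ i + 1) k)
      hg (fun i => (hconv (φ i) k).1)
    change _ ≤ 1 / 2 * Real.logb 2 (1 + W.P k / W.noiseVar k ρ) +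
      1 / 2 * Real.logb 2 (W.condVar k ρ)
    have e : 1 + W.P k / W.noiseVar k ρ = (W.noiseVar k ρ + W.P k) / W.noiseVar k ρ := by
      field_simp
    rw [e, Real.logb, Real.logb, Real.log_div (by positivity) (by positivity), ← mul_add,
      ← add_div, ← mul_div_assoc, le_div_iff₀ hlog2]
    exact h
  · have h := le_of_tendsto_converse (r := R k * Real.log 2) (l := Real.log 2) hN
      (fun i => Nat.succ_pos _) (herr.comp hN) (fun i => hε1 _)
      (fun i => by
        rw [← mul_assoc]
        exact mul_log_two_sub_le_log_messageCount hR0 (φ i + 1) k)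
      tendsto_const_nhds (fun i => (hconv (φ i) k).2)
    rw [Real.logb, ← mul_div_assoc, le_div_iff₀ hlog2]
    exact h
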